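/- Let $G$ be a connected reductive affine algebraic group over $\mathbb C$, realised as a Zariski closed subgroup of some $\mathrm{GL}_n(\mathbb C)$, and let $\sigma_G : G \to G$ be a real form of $G$, that is, an antiholomorphic group automorphism with $\sigma_G\circ\sigma_G = \mathrm{id}_G$. Let $c$ be an element of the center of $G$ with $\sigma_G(c) = c$. Equip $G$ with its classical (Euclidean) topology and the set of $c$-shifted cocycles $$\mathcal Z_c \,=\, \{\, h \in G \;:\; h\,\sigma_G(h) = c \,\}$$ with the subspace topology. Let $H^1_c(\mathbb Z/2\mathbb Z, G)$ be the quotient of $\mathcal Z_c$ by the equivalence relation in which $h \sim b^{-1} h\, \sigma_G(b)$ for all $h\in\mathcal Z_c$ and $b \in G$, equipped with the quotient topology. Then $H^1_c(\mathbb Z/2\mathbb Z, G)$ is discrete. -/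

import Mathlib

open scoped MatrixGroups

namespace LinAlgGroup

/-! ### Linear algebraic groups over `ℂ`, as Zariski closed subgroups of `GL n ℂ` -/

/-- The matrix entries of an invertible matrix, as a point of affine space. -/
def coords {n : ℕ} (g : GL (Fin n) ℂ) : Fin n × Fin n → ℂ :=
  fun ij => (g : Matrix (Fin n) (Fin n) ℂ) ij.1 ij.2

/-- A subset of `GL n ℂ` is Zariski closed if it is the set of common zeros in `GL n ℂ` of a family
of polynomials in the matrix entries. (Allowing powers of `1 / det` in the equations gives the same
closed sets, since these factors can be cleared.) -/
def IsZariskiClosed {n : ℕ} (S : Set (GL (Fin n) ℂ)) : Prop :=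
  ∃ P : Set (MvPolynomial (Fin n × Fin n) ℂ),
    S = {g | ∀ p ∈ P, MvPolynomial.eval (coords g) p = 0}

/-- A Zariski closed subset is connected in the Zariski topology if it is not the union of two
disjoint non-empty Zariski closed subsets. (It is only used for subgroups, which are non-empty.) -/
def IsZariskiConnected {n : ℕ} (S : Set (GL (Fin n) ℂ)) : Prop :=
  ∀ A B : Set (GL (Fin n) ℂ), IsZariskiClosed A → IsZariskiClosed B →
    A ∪ B = S → Disjoint A B → A = ∅ ∨ B = ∅

/-- All elements of the subgroup are unipotent matrices. -/
def IsUnipotent {n : ℕ} (U : Subgroup (GL (Fin n) ℂ)) : Prop :=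
  ∀ u ∈ U, IsNilpotent ((u : Matrix (Fin n) (Fin n) ℂ) - 1)

/-- A Zariski closed subgroup `G` of `GL n ℂ` is reductive if its unipotent radical is trivial: the
only Zariski closed, connected, unipotent, normal subgroup of `G` is the trivial one. -/
def IsReductive {n : ℕ} (G : Subgroup (GL (Fin n) ℂ)) : Prop :=
  ∀ U : Subgroup (GL (Fin n) ℂ), U ≤ G → (U.subgroupOf G).Normal →
    IsZariskiClosed (U : Set (GL (Fin n) ℂ)) → IsZariskiConnected (U : Set (GL (Fin n) ℂ)) →
    IsUnipotent U → U = ⊥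

/-- A self-map of a closed subgroup `G ≤ GL n ℂ` is antiholomorphic if the complex conjugate of
each matrix entry of `σ x` is a holomorphic function of `x ∈ G`, that is, locally the restriction
to the complex submanifold `G` of a holomorphic function on an open set of matrices. -/
def IsAntiholomorphic {n : ℕ} {G : Subgroup (GL (Fin n) ℂ)} (σ : G → G) : Prop :=
  ∀ (g : G) (ij : Fin n × Fin n), ∃ (U : Set (Fin n × Fin n → ℂ)) (F : (Fin n × Fin n → ℂ) → ℂ),
    IsOpen U ∧ coords (g : GL (Fin n) ℂ) ∈ U ∧ DifferentiableOn ℂ F U ∧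
      ∀ x : G, coords (x : GL (Fin n) ℂ) ∈ U →
        starRingEnd ℂ (coords (σ x : GL (Fin n) ℂ) ij) = F (coords (x : GL (Fin n) ℂ))

/-- A real form of `G`: an antiholomorphic involutive group automorphism. -/
structure IsRealForm {n : ℕ} {G : Subgroup (GL (Fin n) ℂ)} (σ : G →* G) : Prop where
  involutive : Function.Involutive σ
  antiholomorphic : IsAntiholomorphic σ

end LinAlgGroup

/-! ### Shifted non-abelian cohomology of `ℤ/2ℤ` -/

namespace ShiftedCohomology

/-- The set of `c`-shifted cocycles: the elements `h` with `h * σ h = c`. -/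
def cocycles {Γ : Type*} [Group Γ] (σ : Γ →* Γ) (c : Γ) : Set Γ :=
  {h | h * σ h = c}

/-- The coboundary equivalence `h ∼ b⁻¹ * h * σ b` on shifted cocycles. -/
def coboundarySetoid {Γ : Type*} [Group Γ] (σ : Γ →* Γ) (c : Γ) : Setoid (cocycles σ c) where
  r h k := ∃ b : Γ, (k : Γ) = b⁻¹ * (h : Γ) * σ b
  iseqv :=
    { refl := fun h => ⟨1, by simp⟩
      symm := by
        rintro h k ⟨b, hb⟩
        exact ⟨b⁻¹, by rw [hb, map_inv]; group⟩
      trans := by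
        rintro h k l ⟨b, hb⟩ ⟨d, hd⟩
        exact ⟨b * d, by rw [hd, hb, map_mul]; group⟩ }

/-- The `c`-shifted non-abelian cohomology set `H¹_c(ℤ/2ℤ, Γ)`, where the non-trivial element of
`ℤ/2ℤ` acts on `Γ` by `σ`. -/
def H1 {Γ : Type*} [Group Γ] (σ : Γ →* Γ) (c : Γ) : Type _ :=
  Quotient (coboundarySetoid σ c)

/-- `H¹_c` carries the quotient topology of the subspace topology on the set of cocycles. -/
instance instTopologicalSpaceH1 {Γ : Type*} [Group Γ] [TopologicalSpace Γ] (σ : Γ →* Γ) (c : Γ) :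
    TopologicalSpace (H1 σ c) :=
  inferInstanceAs (TopologicalSpace (Quotient (coboundarySetoid σ c)))

end ShiftedCohomology

open Filter Topology Polynomial

/-! Every class of cocycles is open. A cocycle near `h` is `y * y * h` with `y` near `1` in `G`;
since `c` is central, the cocycle condition makes `y` and `(h * σ y * h⁻¹)⁻¹` square roots of the
same element, hence equal, and then `y * y * h = y * h * (σ y)⁻¹` is cohomologous to `h`. This needs
squaring to be locally invertible at `1` in `G`. In `GL n ℂ` that is the inverse function theorem;
that the root of an element of `G` stays in `G` is shown without Lie theory: a matrix near `1` is an
even polynomial in itself, so equations holding at the powers of `y * y` hold at `y`. -/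

/-- If `σ` is a continuous endomorphism of a topological group in which squaring is injective and
open near `1`, then the shifted cohomology of `σ` is discrete. -/
theorem ShiftedCohomology.discreteTopology_H1 {Γ : Type*} [Group Γ] [TopologicalSpace Γ]
    [IsTopologicalGroup Γ] (σ : Γ →* Γ) (hcont : Continuous σ)
    (c : Γ) (hc : c ∈ Subgroup.center Γ)
    (hopen : ∀ U ∈ 𝓝 (1 : Γ), (fun y : Γ => y * y) '' U ∈ 𝓝 (1 : Γ))
    (hinj : ∃ U ∈ 𝓝 (1 : Γ), Set.InjOn (fun y : Γ => y * y) U) :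
    DiscreteTopology (H1 σ c) := by
  have key : ∀ h : cocycles σ c, {k : cocycles σ c | coboundarySetoid σ c h k} ∈ 𝓝 h := by
    rintro ⟨h, hh⟩
    obtain ⟨U, hU, hUinj⟩ := hinj
    have hz : Continuous fun y : Γ => (h * σ y * h⁻¹)⁻¹ := by fun_prop
    have hzU : {y : Γ | (h * σ y * h⁻¹)⁻¹ ∈ U} ∈ 𝓝 (1 : Γ) :=
      hz.continuousAt.preimage_mem_nhds (by simpa using hU)
    have hx : Continuous fun k : cocycles σ c => (k : Γ) * h⁻¹ := by fun_prop
    have := hx.continuousAt.preimage_mem_nhds (x := ⟨h, hh⟩)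
      -- Both candidate roots, `y` and `(h * σ y * h⁻¹)⁻¹`, must lie where squaring is injective.
      (t := _) (by simpa only [mul_inv_cancel] using hopen _ (inter_mem hU hzU))
    filter_upwards [this]
    rintro ⟨k, hk⟩ ⟨y, ⟨hyU, hyz⟩, hy⟩
    simp only at hy
    have hkeq : k = y * y * h := by rw [hy]; group
    have hcomm : ∀ g, g * c = c * g := fun g => Subgroup.mem_center_iff.mp hc g
    have hh' : h * σ h = c := hh
    have hk' : k * σ k = c := hk
    have hsq : (h * σ y * h⁻¹)⁻¹ * (h * σ y * h⁻¹)⁻¹ = y * y := by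
      have h1 : (y * y) * (h * σ y * h⁻¹ * (h * σ y * h⁻¹)) * c = c := by
        conv_rhs => rw [← hk', hkeq]
        simp only [map_mul]
        have h2 : c = h * σ h := hh'.symm
        have h3 : h⁻¹ * c = σ h := by rw [h2]; group
        calc _ = y * y * h * σ y * σ y * (h⁻¹ * c) := by group
          _ = _ := by rw [h3]; group
      have h4 : (y * y) * (h * σ y * h⁻¹ * (h * σ y * h⁻¹)) = 1 := mul_eq_right.mp h1
      rw [← mul_inv_rev]
      exact (eq_inv_of_mul_eq_one_left h4).symm
    have hyeq : (h * σ y * h⁻¹)⁻¹ = y := hUinj hyz hyU hsq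
    refine ⟨y⁻¹, ?_⟩
    simp only [inv_inv, map_inv]
    rw [hkeq]
    nth_rewrite 2 [← hyeq]
    group
  rw [discreteTopology_iff_isOpen_singleton]
  intro q
  obtain ⟨h, rfl⟩ := Quotient.exists_rep q
  refine (isQuotientMap_quotient_mk' (s := coboundarySetoid σ c)).isOpen_preimage.mp ?_
  rw [isOpen_iff_mem_nhds]
  intro k hk
  filter_upwards [key k] with l hl
  have hk' : (Quotient.mk (coboundarySetoid σ c) k) = Quotient.mk _ h := hk
  exact (Quotient.sound (s := coboundarySetoid σ c) hl).symm.trans hk'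

/-! ### Squaring near `1` in a Banach algebra -/

section Squaring

variable {R : Type*} [NormedRing R] [NormedAlgebra ℂ R]

/-- The derivative at `1` is multiplication by `2`, which is invertible: input for the inverse
function theorem. -/
theorem hasStrictFDerivAt_mul_self_one :
    HasStrictFDerivAt (fun y : R => y * y)
      ((ContinuousLinearEquiv.smulLeft (Units.mk0 (2 : ℂ) two_ne_zero) : R ≃L[ℂ] R) : R →L[ℂ] R)
      1 := by
  have h := (hasStrictFDerivAt_id (𝕜 := ℂ) (1 : R)).mul' (hasStrictFDerivAt_id (𝕜 := ℂ) (1 : R))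
  refine h.congr_fderiv ?_
  ext v
  simp [two_smul, Units.smul_def]

variable [CompleteSpace R]

theorem Units.image_mul_self_mem_nhds_one {U : Set Rˣ} (hU : U ∈ 𝓝 (1 : Rˣ)) :
    (fun y : Rˣ => y * y) '' U ∈ 𝓝 (1 : Rˣ) := by
  have h := (hasStrictFDerivAt_mul_self_one (R := R)).map_nhds_eq_of_equiv
  have hU' : (Units.val '' U : Set R) ∈ 𝓝 (1 : R) := by
    have := (Units.isOpenEmbedding_val (R := R)).isOpenMap.image_mem_nhds hU
    simpa using this
  have h2 := image_mem_map (m := fun y : R => y * y) hU'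
  rw [h, one_mul] at h2
  have h3 := Units.continuous_val.continuousAt.preimage_mem_nhds (x := (1 : Rˣ))
    (t := _) (by simpa using h2)
  filter_upwards [h3]
  rintro x ⟨_, ⟨y, hy, rfl⟩, hxy⟩
  exact ⟨y, hy, Units.ext hxy⟩

theorem Units.exists_injOn_mul_self :
    ∃ U ∈ 𝓝 (1 : Rˣ), Set.InjOn (fun y : Rˣ => y * y) U := by
  let e := (hasStrictFDerivAt_mul_self_one (R := R)).toOpenPartialHomeomorph _
  have he : e.source ∈ 𝓝 (1 : R) :=
    e.open_source.mem_nhds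
      (hasStrictFDerivAt_mul_self_one (R := R)).mem_toOpenPartialHomeomorph_source
  refine ⟨_, Units.continuous_val.continuousAt.preimage_mem_nhds (by simpa using he), ?_⟩
  intro y hy z hz hyz
  exact Units.ext (e.injOn hy hz (congrArg Units.val hyz))

end Squaring

/-! ### Even polynomials fixing a matrix near `1` -/

section EvenPolynomial

attribute [local instance] Matrix.linftyOpNormedRing Matrix.linftyOpNormedAlgebra

/-- A matrix close to `1` is an even polynomial in itself. -/
theorem Matrix.exists_even_polynomial_aeval_eq_self {m : Type*} [Fintype m] [DecidableEq m]
    (T : Matrix m m ℂ) (hT : ‖T - 1‖ < 1) :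
    ∃ h : ℂ[X], (∀ k, Odd k → h.coeff k = 0) ∧ aeval T h = T := by
  -- Eigenvalues in the right half-plane are never negatives of one another, so `q(X)` and `q(-X)`
  -- are coprime.
  have hroot : ∀ μ : ℂ, T.charpoly.eval μ = 0 → 0 < μ.re := by
    intro μ hμ
    have hspec : μ ∈ spectrum ℂ T := Matrix.mem_spectrum_iff_isRoot_charpoly.mpr hμ
    have h1 : μ - 1 ∈ spectrum ℂ (T - 1) := by
      have := spectrum.sub_singleton_eq T (1 : ℂ)
      rw [map_one] at this
      rw [← this]
      exact Set.sub_mem_sub hspec rfl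
    rcases isEmpty_or_nonempty m with hm | hm
    · rw [Subsingleton.elim T 0, spectrum.of_subsingleton] at hspec
      exact hspec.elim
    · have h2 := (spectrum.norm_le_norm_of_mem h1).trans_lt hT
      have h3 := (Complex.abs_re_le_norm (μ - 1)).trans_lt h2
      rw [Complex.sub_re, Complex.one_re, abs_lt] at h3
      linarith
  have hcop : IsCoprime T.charpoly (T.charpoly.comp (-X)) := by
    rw [Polynomial.isCoprime_iff_aeval_ne_zero_of_isAlgClosed ℂ ℂ]
    intro μ
    by_contra! hμ
    obtain ⟨h1, h2⟩ := hμ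
    simp only [coe_aeval_eq_eval, eval_comp, eval_neg, eval_X] at h1 h2
    have := hroot _ h1
    have := hroot _ h2
    simp only [Complex.neg_re] at this
    linarith
  obtain ⟨a, b, hab⟩ := hcop
  set q := T.charpoly
  have hq : aeval T q = 0 := Matrix.aeval_self_charpoly T
  -- By Bézout, `g` is `X` modulo `q` and `-X` modulo `q(-X)`. Hence `g(-X)` is also `X` modulo `q`,
  -- and the even part of `g` fixes `T`.
  have hg : q.comp (-X) * (C 2 * X * b) = X + X * (1 - C 2 * a * q) := by
    have : q.comp (-X) * b = 1 - a * q := by rw [← hab]; ring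
    calc _ = C 2 * X * (q.comp (-X) * b) := by ring
      _ = _ := by rw [this]; simp only [map_ofNat]; ring
  set g : ℂ[X] := X * (1 - C 2 * a * q) with hgdef
  have hgT : aeval T g = T := by simp [hgdef, hq]
  have hgT' : aeval T (g.comp (-X)) = T := by
    have h1 : g.comp (-X) = q * (C 2 * X * b).comp (-X) + X := by
      have := congrArg (fun r : ℂ[X] => r.comp (-X)) hg
      simp only [mul_comp, add_comp, X_comp, comp_assoc, neg_comp, neg_neg, comp_X] at this
      simp only [mul_comp, X_comp]
      rw [this]; ring
    rw [h1]; simp [hq]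
  refine ⟨C (1 / 2) * (g + g.comp (-X)), ?_, ?_⟩
  · intro k hk
    have : g.comp (-X) = g.comp (C (-1) * X) := by simp
    rw [coeff_C_mul, coeff_add, this, comp_C_mul_X_coeff, hk.neg_one_pow]
    ring
  · rw [map_mul, map_add, hgT, hgT', aeval_C, ← two_smul ℂ T, Algebra.algebraMap_eq_smul_one,
      smul_mul_smul_comm]
    norm_num

end EvenPolynomial

/-! ### Polynomial functions as matrix coefficients -/

namespace LinAlgGroup

/-- A function on `GL n ℂ` is a matrix coefficient if it is a linear functional of a continuous
finite-dimensional matrix representation. -/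
def IsMatrixCoeff {n : ℕ} (f : GL (Fin n) ℂ → ℂ) : Prop :=
  ∃ (m : Type) (_ : Fintype m) (_ : DecidableEq m) (ρ : GL (Fin n) ℂ →* Matrix m m ℂ)
    (L : Matrix m m ℂ →ₗ[ℂ] ℂ), Continuous ρ ∧ ∀ g, f g = L (ρ g)

namespace IsMatrixCoeff

variable {n : ℕ} {f f' : GL (Fin n) ℂ → ℂ}

theorem const (a : ℂ) : IsMatrixCoeff fun _ : GL (Fin n) ℂ => a :=
  ⟨Unit, inferInstance, inferInstance, 1, a • Matrix.traceLinearMap Unit ℂ ℂ, continuous_const,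
    fun g => by simp⟩

theorem coord (ij : Fin n × Fin n) : IsMatrixCoeff fun g => coords g ij :=
  ⟨Fin n, inferInstance, inferInstance, Units.coeHom _, Matrix.entryLinearMap ℂ ℂ ij.1 ij.2,
    Units.continuous_val, fun g => rfl⟩

/-- Direct sum of the two representations. -/
theorem add (hf : IsMatrixCoeff f) (hf' : IsMatrixCoeff f') :
    IsMatrixCoeff fun g => f g + f' g := by
  obtain ⟨m, _, _, ρ, L, hρ, hL⟩ := hf
  obtain ⟨m', _, _, ρ', L', hρ', hL'⟩ := hf'
  refine ⟨m ⊕ m', inferInstance, inferInstance,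
    { toFun := fun g => Matrix.fromBlocks (ρ g) 0 0 (ρ' g)
      map_one' := by simp
      map_mul' := fun x y => by simp [Matrix.fromBlocks_multiply] },
    { toFun := fun M => L M.toBlocks₁₁ + L' M.toBlocks₂₂
      map_add' := fun M N => by
        rw [show (M + N).toBlocks₁₁ = M.toBlocks₁₁ + N.toBlocks₁₁ from rfl,
          show (M + N).toBlocks₂₂ = M.toBlocks₂₂ + N.toBlocks₂₂ from rfl, map_add, map_add]
        ring
      map_smul' := fun a M => by
        rw [show (a • M).toBlocks₁₁ = a • M.toBlocks₁₁ from rfl,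
          show (a • M).toBlocks₂₂ = a • M.toBlocks₂₂ from rfl, map_smul, map_smul, RingHom.id_apply,
          smul_add] }, ?_, fun g => ?_⟩
  · exact hρ.matrix_fromBlocks continuous_const continuous_const hρ'
  · simp [hL, hL']

/-- Tensor product of the two representations. -/
theorem mul (hf : IsMatrixCoeff f) (hf' : IsMatrixCoeff f') :
    IsMatrixCoeff fun g => f g * f' g := by
  obtain ⟨m, _, _, ρ, L, hρ, hL⟩ := hf
  obtain ⟨m', _, _, ρ', L', hρ', hL'⟩ := hf'
  refine ⟨m × m', inferInstance, inferInstance,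
    { toFun := fun g => Matrix.kronecker (ρ g) (ρ' g)
      map_one' := by simp
      map_mul' := fun x y => by simp [Matrix.mul_kronecker_mul] },
    TensorProduct.lift ((LinearMap.mul ℂ ℂ).compl₁₂ L L') ∘ₗ
      (kroneckerLinearEquiv m m m' m' ℂ ).symm.toLinearMap, ?_, fun g => ?_⟩
  · exact continuous_matrix fun i j => (hρ.matrix_elem _ _).mul (hρ'.matrix_elem _ _)
  · simp [hL, hL']

theorem eval_coords (p : MvPolynomial (Fin n × Fin n) ℂ) :
    IsMatrixCoeff fun g => MvPolynomial.eval (coords g) p := by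
  induction p using MvPolynomial.induction_on with
  | C a => simpa using const a
  | add p q hp hq => simpa using hp.add hq
  | mul_X p i hp => simpa using hp.mul (coord i)

attribute [local instance] Matrix.linftyOpNormedRing Matrix.linftyOpNormedAlgebra in
/-- For `y` near `1`, a matrix coefficient vanishing at the even powers of `y` vanishes at `y`. -/
theorem eventually_eq_zero (hf : IsMatrixCoeff f) :
    ∀ᶠ y in 𝓝 (1 : GL (Fin n) ℂ), (∀ k : ℕ, Even k → f (y ^ k) = 0) → f y = 0 := by
  obtain ⟨m, _, _, ρ, L, hρ, hL⟩ := hf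
  have hev : ∀ᶠ y in 𝓝 (1 : GL (Fin n) ℂ), ‖ρ y - 1‖ < 1 := by
    have h1 : Continuous fun y => ‖ρ y - 1‖ := (hρ.sub continuous_const).norm
    exact h1.continuousAt.eventually_lt continuousAt_const (by simp)
  filter_upwards [hev] with y hy hk
  obtain ⟨h, hodd, hh⟩ := Matrix.exists_even_polynomial_aeval_eq_self (ρ y) hy
  rw [hL, ← hh, aeval_eq_sum_range, map_sum]
  refine Finset.sum_eq_zero fun k _ => ?_
  rcases Nat.even_or_odd k with he | ho
  · rw [map_smul, ← map_pow, ← hL, hk k he, smul_zero]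
  · rw [hodd k ho, zero_smul, map_zero]

end IsMatrixCoeff

variable {n : ℕ}

/-- Hilbert's basis theorem. Each equation has its own neighbourhood of `1`, and only finitely many
may be intersected. -/
theorem IsZariskiClosed.exists_finset {S : Set (GL (Fin n) ℂ)} (hS : IsZariskiClosed S) :
    ∃ P : Finset (MvPolynomial (Fin n × Fin n) ℂ),
      S = {g | ∀ p ∈ P, MvPolynomial.eval (coords g) p = 0} := by
  obtain ⟨P, rfl⟩ := hS
  obtain ⟨F, hF⟩ := IsNoetherian.noetherian (Ideal.span P)
  have vanish : ∀ (Q : Set (MvPolynomial (Fin n × Fin n) ℂ)) (g : GL (Fin n) ℂ),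
      (∀ p ∈ Q, MvPolynomial.eval (coords g) p = 0) ↔
        Ideal.span Q ≤ RingHom.ker (MvPolynomial.eval (coords g)) := fun Q g =>
    (Ideal.span_le (s := Q) (I := RingHom.ker (MvPolynomial.eval (coords g)))).symm
  refine ⟨F, Set.ext fun g => ?_⟩
  refine (vanish P g).trans (Iff.trans ?_ (vanish F g).symm)
  rw [← hF, Ideal.span]

/-- Near `1`, an algebraic group contains the square roots of its elements. -/
theorem IsZariskiClosed.eventually_mem_of_mul_self_mem {G : Subgroup (GL (Fin n) ℂ)}
    (hG : IsZariskiClosed (G : Set (GL (Fin n) ℂ))) :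
    ∀ᶠ y in 𝓝 (1 : GL (Fin n) ℂ), y * y ∈ G → y ∈ G := by
  obtain ⟨P, hP⟩ := hG.exists_finset
  have hmem : ∀ g, g ∈ G ↔ ∀ p ∈ P, MvPolynomial.eval (coords g) p = 0 := fun g => by
    rw [← SetLike.mem_coe, hP]; rfl
  have := (Filter.eventually_all_finset P).mpr fun p _ =>
    (IsMatrixCoeff.eval_coords p).eventually_eq_zero
  filter_upwards [this] with y hy hyy
  refine (hmem y).mpr fun p hp => hy p hp fun k hk => ?_
  obtain ⟨j, rfl⟩ := hk
  refine (hmem _).mp ?_ p hp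
  -- Even powers of `y` are powers of `y * y`, so they lie in `G`.
  rw [pow_add, ← (Commute.refl y).mul_pow]
  exact G.pow_mem hyy j

theorem continuous_coords : Continuous (coords : GL (Fin n) ℂ → Fin n × Fin n → ℂ) :=
  continuous_pi fun ij => Units.continuous_val.matrix_elem ij.1 ij.2

attribute [local instance] Matrix.linftyOpNormedRing Matrix.linftyOpNormedAlgebra in
theorem IsAntiholomorphic.continuous {G : Subgroup (GL (Fin n) ℂ)} {σ : G → G}
    (hσ : IsAntiholomorphic σ) : Continuous σ := by
  refine continuous_induced_rng.mpr
    ((Units.isOpenEmbedding_val (R := Matrix (Fin n) (Fin n) ℂ)).isInducing.continuous_iff.mpr ?_)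
  refine continuous_matrix fun i j => continuous_iff_continuousAt.mpr fun g => ?_
  obtain ⟨U, F, hU, hgU, hF, h⟩ := hσ g (i, j)
  have hc : Continuous fun x : G => coords (x : GL (Fin n) ℂ) :=
    continuous_coords.comp continuous_subtype_val
  have h1 : ContinuousAt (fun x : G => starRingEnd ℂ (F (coords (x : GL (Fin n) ℂ)))) g :=
    Complex.continuous_conj.continuousAt.comp
      (ContinuousAt.comp (g := F) (hF.continuousOn.continuousAt (hU.mem_nhds hgU))
        hc.continuousAt)
  refine h1.congr ?_
  filter_upwards [hc.continuousAt.preimage_mem_nhds (hU.mem_nhds hgU)] with x hx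
  rw [← h x hx, Complex.conj_conj]
  rfl

attribute [local instance] Matrix.linftyOpNormedRing Matrix.linftyOpNormedAlgebra in
theorem IsZariskiClosed.image_mul_self_mem_nhds_one {G : Subgroup (GL (Fin n) ℂ)}
    (hG : IsZariskiClosed (G : Set (GL (Fin n) ℂ))) {U : Set G} (hU : U ∈ 𝓝 (1 : G)) :
    (fun y : G => y * y) '' U ∈ 𝓝 (1 : G) := by
  obtain ⟨V, hV, hVU⟩ := mem_nhds_induced _ _ _ |>.mp hU
  have h1 := Units.image_mul_self_mem_nhds_one (R := Matrix (Fin n) (Fin n) ℂ)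
    (inter_mem hV hG.eventually_mem_of_mul_self_mem)
  filter_upwards [continuous_subtype_val.continuousAt.preimage_mem_nhds (x := (1 : G)) h1]
  rintro ⟨x, hx⟩ ⟨y, ⟨hyV, hyG⟩, hyx⟩
  have hyx' : y * y = x := hyx
  exact ⟨⟨y, hyG (hyx' ▸ hx)⟩, hVU hyV, Subtype.ext hyx'⟩

attribute [local instance] Matrix.linftyOpNormedRing Matrix.linftyOpNormedAlgebra in
theorem exists_injOn_mul_self (G : Subgroup (GL (Fin n) ℂ)) :
    ∃ U ∈ 𝓝 (1 : G), Set.InjOn (fun y : G => y * y) U := by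
  obtain ⟨V, hV, hinj⟩ := Units.exists_injOn_mul_self (R := Matrix (Fin n) (Fin n) ℂ)
  refine ⟨Subtype.val ⁻¹' V,
    continuous_subtype_val.continuousAt.preimage_mem_nhds (x := (1 : G)) hV, ?_⟩
  intro y hy z hz hyz
  exact Subtype.ext (hinj hy hz (congrArg Subtype.val hyz))

end LinAlgGroup

theorem proposition2p1 (n : ℕ) (G : Subgroup (GL (Fin n) ℂ))
    (hclosed : LinAlgGroup.IsZariskiClosed (G : Set (GL (Fin n) ℂ)))
    (hconn : LinAlgGroup.IsZariskiConnected (G : Set (GL (Fin n) ℂ)))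
    (hred : LinAlgGroup.IsReductive G)
    (σ : G →* G) (hσ : LinAlgGroup.IsRealForm σ)
    (c : G) (hcenter : c ∈ Subgroup.center G) (hreal : σ c = c) :
    DiscreteTopology (ShiftedCohomology.H1 σ c) :=
  ShiftedCohomology.discreteTopology_H1 σ hσ.antiholomorphic.continuous c hcenter
    (fun _ hU => hclosed.image_mul_self_mem_nhds_one hU)
    (LinAlgGroup.exists_injOn_mul_self G)
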